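/- Conventions. Compact spaces are Hausdorff, Banach spaces are real, $C(K)$ is the Banach space of continuous real-valued functions on the compact space $K$, and $\mathfrak c$ is the cardinality of the continuum. For a cardinal $\kappa$, $\mathrm{MA}(\kappa)$ is the statement: for every nonempty partially ordered set $\mathbb P$ in which every uncountable subset contains two distinct elements with a common upper bound, and every family of at most $\kappa$ sets $D\subseteq\mathbb P$ that are dense (for each $p\in\mathbb P$ there is $d\in D$ with $p\le d$), there is a directed set $G\subseteq\mathbb P$ (any two elements of $G$ have an upper bound in $G$) that meets every member of the family. $\mathrm{MA}$ is the statement that $\mathrm{MA}(\kappa)$ holds for every $\kappa<\mathfrak c$, and $\mathrm{CH}$ is the statement $\mathfrak c=\aleph_1$. For a compact space $K$, let $M_1(K)$ be the closed unit ball of $C(K)^*$ (identified with the space of signed Radon measures on $K$ of finite variation) with the weak$^*$ topology. A countable discrete extension of a compact space $L$ is a compact space $L'\supseteq L$ such that $L'\setminus L$ is countable and discrete. The space $K$ has the $^*$extension property if for every countable discrete extension $L'$ of $M_1(K)$ there is a bounded linear operator $E:C(K)\to C(L')$ such that $Eg(\nu)=\nu(g)$ for all $g\in C(K)$ and $\nu\in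 M_1(K)$. A twisted sum of Banach spaces $Z$ and $Y$ is a short exact sequence $0\to Z\xrightarrow{i}X\to Y\to 0$ of bounded linear operators with $X$ a Banach space; it is trivial if $i$ has a bounded linear left inverse $X\to Z$. Corollary. Let $\kappa<\mathfrak c$ be a cardinal number such that $\mathrm{MA}(\kappa)$ holds. Then the Cantor cube $2^\kappa=\{0,1\}^\kappa$ (with the product topology) has the $^*$extension property, and every twisted sum of $c_0$ and $C(2^\kappa)$ is trivial. In particular, under $\mathrm{MA}+\neg\mathrm{CH}$ every twisted sum of $c_0$ and $C(2^{\omega_1})$ is trivial. -/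

import Mathlib

open scoped Cardinal ZeroAtInfty

universe u v w

namespace TwistedSums

section MartinsAxiom

/-- Two conditions of an ordered set are compatible if they have a common upper bound
(forcing properties are read upwards here). -/
def Compatible {P : Type u} [PartialOrder P] (p q : P) : Prop :=
  ∃ r : P, p ≤ r ∧ q ≤ r

/-- The countable chain condition: every uncountable set of conditions contains two distinct
compatible ones. -/
def CCC (P : Type u) [PartialOrder P] : Prop :=
  ∀ A : Set P, ¬ A.Countable → ∃ p ∈ A, ∃ q ∈ A, p ≠ q ∧ Compatible p q

/-- `D` is dense: every condition has an element of `D` above it. -/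
def IsDenseSet {P : Type u} [PartialOrder P] (D : Set P) : Prop :=
  ∀ p : P, ∃ d ∈ D, p ≤ d

/-- `MA(κ)`: in a nonempty ccc partially ordered set, any family of at most `κ` dense sets
is met by some directed set. -/
def MartinsAxiomAt (κ : Cardinal.{u}) : Prop :=
  ∀ (P : Type u) [PartialOrder P] [Nonempty P], CCC P →
    ∀ 𝒟 : Set (Set P), #𝒟 ≤ κ → (∀ D ∈ 𝒟, IsDenseSet D) →
      ∃ G : Set P, DirectedOn (· ≤ ·) G ∧ ∀ D ∈ 𝒟, (G ∩ D).Nonempty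

/-- `MA`: `MA(κ)` holds for every `κ < 𝔠`. -/
def MartinsAxiom : Prop :=
  ∀ κ : Cardinal.{u}, κ < 𝔠 → MartinsAxiomAt κ

/-- `CH`: the continuum is the first uncountable cardinal. -/
def ContinuumHypothesis : Prop :=
  (𝔠 : Cardinal.{u}) = ℵ₁

end MartinsAxiom

section TwistedSum

variable {Z X Y : Type*} [NormedAddCommGroup Z] [NormedSpace ℝ Z]
  [NormedAddCommGroup X] [NormedSpace ℝ X] [NormedAddCommGroup Y] [NormedSpace ℝ Y]

/-- `0 → Z → X → Y → 0` is a short exact sequence of bounded operators. -/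
structure IsTwistedSum (i : Z →L[ℝ] X) (q : X →L[ℝ] Y) : Prop where
  injective : Function.Injective i
  exact : Function.Exact i q
  surjective : Function.Surjective q

/-- A short exact sequence `0 → Z → X → Y → 0` splits if `i : Z → X` has a bounded
left inverse. -/
def Splits (i : Z →L[ℝ] X) : Prop :=
  ∃ p : X →L[ℝ] Z, p.comp i = ContinuousLinearMap.id ℝ Z

end TwistedSum

/-- The Banach space of real null sequences with the supremum norm
(continuous functions on the discrete space `ℕ` that vanish at infinity). -/
abbrev NullSeq : Type := C₀(ℕ, ℝ)

/-- Every twisted sum of `c₀` and `Y` is trivial, the middle space running over all real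
Banach spaces in the universe `v`. -/
def AllTwistedSumsTrivial (Y : Type u) [NormedAddCommGroup Y] [NormedSpace ℝ Y] : Prop :=
  ∀ (X : Type v) [NormedAddCommGroup X] [NormedSpace ℝ X] [CompleteSpace X]
    (i : NullSeq →L[ℝ] X) (q : X →L[ℝ] Y), IsTwistedSum i q → Splits i

section StarExtension

/-- `M₁(K)`: the closed unit ball of `C(K)*` (identified with the signed Radon measures on `K`
normed by total variation), with the weak* topology. -/
abbrev MeasureBall (K : Type u) [TopologicalSpace K] [CompactSpace K] : Type u :=
  {ν : WeakDual ℝ C(K, ℝ) // ‖WeakDual.toStrongDual ν‖ ≤ 1}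

/-- The embedding `e` exhibits the compact (Hausdorff) space `L'` as a countable discrete extension
of the space `L`: the remainder of the copy of `L` is countable and discrete. -/
structure IsCountableDiscreteExtension {L : Type u} {L' : Type w} [TopologicalSpace L]
    [TopologicalSpace L'] [CompactSpace L'] [T2Space L'] (e : L → L') : Prop where
  isEmbedding : Topology.IsEmbedding e
  countable_compl : (Set.range e)ᶜ.Countable
  discrete_compl : DiscreteTopology ((Set.range e)ᶜ : Set L')

/-- The *extension property of the compact space `K`: for every countable discrete extension
`L'` of `M₁(K)`, in the universe `w`, there is a bounded operator `E : C(K) → C(L')` with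
`E g (ν) = ν(g)` for `g ∈ C(K)` and `ν ∈ M₁(K)`. -/
def StarExtensionProperty (K : Type u) [TopologicalSpace K] [CompactSpace K] : Prop :=
  ∀ (L' : Type w) [TopologicalSpace L'] [CompactSpace L'] [T2Space L']
    (e : MeasureBall K → L'),
    IsCountableDiscreteExtension e →
      ∃ E : C(K, ℝ) →L[ℝ] C(L', ℝ),
        ∀ (g : C(K, ℝ)) (ν : MeasureBall K), E g (e ν) = ν.1 g

end StarExtension

end TwistedSums

namespace TwistedSums

open Filter Topology

variable {I : Type u}

/-! Both conclusions reduce to one asymptotic problem, solved by `exists_asymptotic_functionals`.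
Numbers `θ S n` are given such that, for each finite `J` and each `ε`, almost every `n` admits a
functional of norm at most `r` within `ε` of `θ · n` on the cylinder functions over `J`. One bounded
sequence of functionals has to match `θ` asymptotically on all cylinder functions at once. Since `κ
< 𝔠`, the cube is separable, so countably many functionals suffice as candidates, and the task is to
choose an index for each `n`. `MA` does this (`exists_uniformization`): a condition is a finite list
of indices with a promise `(J, ε)`. Conditions with the same list are compatible by
`exists_amalgamation`, and there are only countably many lists, so ccc holds.

For the extension property, `θ` records Tietze extensions to `L'` of the evaluations at cylinder
functions; compactness of `L'` gives the approximations. The sequence obtained extends the identity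
on `M₁` to a bounded weak*-continuous family on `L'`.

For a twisted sum, the coordinate functionals of `c₀` extend to a bounded sequence `f n` on `X`. Its
weak* cluster points vanish on `c₀`, hence factor through `q`, so the `f n` are approximated by
functionals from the quotient. Subtracting the resulting `μ n ∘ q` makes the sequence weak* null
without changing it on `c₀`, which yields the left inverse. -/

/-! ### Uniformization from Martin's axiom -/

/-- The **Rasiowa–Sikorski lemma**: `MA(ℵ₀)` holds. -/
theorem martinsAxiomAt_aleph0 : MartinsAxiomAt.{u} ℵ₀ := by
  intro P _ _ _ 𝒟 h𝒟 hD
  have hc : Countable 𝒟 := Cardinal.mk_le_aleph0_iff.1 h𝒟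
  have := Encodable.ofCountable 𝒟
  let C : 𝒟 → Order.Cofinal P := fun D ↦ ⟨D.1, fun p ↦ hD D.1 D.2 p⟩
  let p : P := Classical.arbitrary P
  refine ⟨Order.idealOfCofinals p C, (Order.idealOfCofinals p C).directed, fun D hDm ↦ ?_⟩
  obtain ⟨x, hx, hx'⟩ := Order.cofinal_meets_idealOfCofinals p C ⟨D, hDm⟩
  exact ⟨x, hx', hx⟩

/-- A list can be prolonged to any length by entries satisfying a relation which has
solutions at all later indices. -/
theorem exists_prefix_forall_getElem? {R : ℕ → ℕ → Prop} (s : List ℕ)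
    (h : ∀ n, s.length ≤ n → ∃ m, R n m) (N : ℕ) :
    ∃ t, s <+: t ∧ N ≤ t.length ∧ ∀ n m, s.length ≤ n → t[n]? = some m → R n m := by
  induction N with
  | zero =>
    refine ⟨s, List.prefix_rfl, Nat.zero_le _, fun n m hn hm ↦ ?_⟩
    rw [List.getElem?_eq_none hn] at hm
    cases hm
  | succ N ih =>
    obtain ⟨t, hst, hN, ht⟩ := ih
    obtain ⟨m, hm⟩ := h t.length hst.length_le
    refine ⟨t ++ [m], hst.trans (List.prefix_append _ _), by simpa using hN, ?_⟩
    intro n k hn hk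
    rcases lt_trichotomy n t.length with hlt | rfl | hgt
    · rw [List.getElem?_append_left hlt] at hk
      exact ht n k hn hk
    · simp only [List.getElem?_concat_length, Option.some.injEq] at hk
      exact hk ▸ hm
    · rw [List.getElem?_eq_none (by simpa using hgt)] at hk
      cases hk

theorem getElem?_eq_of_prefix {s t : List ℕ} (h : s <+: t) {n m : ℕ} (hm : s[n]? = some m) :
    t[n]? = some m := by
  obtain ⟨hn, rfl⟩ := List.getElem?_eq_some_iff.1 hm
  exact List.prefix_iff_getElem?.1 h n hn

/-- A finite sequence together with a requirement `promise` that its further terms have to meet. -/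
structure PromiseSequence {A : Type u} (Ex : A → ℕ → Prop) : Type u where
  promise : A
  values : List ℕ
  valid : ∀ n, values.length ≤ n → Ex promise n

/-- Uniformization from Martin's axiom. Suppose that for each requirement `a` and almost all `n`
the statement `Ex a n` holds, and that `Ex a n` and `Ex b n` together produce a value satisfying
both requirements at `n`. Then some sequence satisfies each requirement at almost all indices. -/
theorem exists_uniformization {κ : Cardinal.{u}} (hκ : ℵ₀ ≤ κ) (hMA : MartinsAxiomAt κ)
    {A : Type u} [SemilatticeSup A] [Nonempty A] (hA : #A ≤ κ)
    (Ex : A → ℕ → Prop) (Good : A → ℕ → ℕ → Prop)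
    (anti : ∀ {a b n m}, a ≤ b → Good b n m → Good a n m)
    (ev : ∀ a, ∃ N, ∀ n, N ≤ n → Ex a n)
    (amalg : ∀ {a b n}, Ex a n → Ex b n → ∃ m, Good a n m ∧ Good b n m) :
    ∃ f : ℕ → ℕ, ∀ a, ∃ N, ∀ n, N ≤ n → Good a n (f n) := by
  let P := PromiseSequence Ex
  let _ : PartialOrder P :=
    { le := fun p q ↦ p.promise ≤ q.promise ∧ p.values <+: q.values ∧
        ∀ n m, p.values.length ≤ n → q.values[n]? = some m → Good p.promise n m
      le_refl := fun p ↦ ⟨le_rfl, List.prefix_rfl, fun n m hn hm ↦ by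
        rw [List.getElem?_eq_none hn] at hm; cases hm⟩
      le_trans := fun p q r hpq hqr ↦ ⟨hpq.1.trans hqr.1, hpq.2.1.trans hqr.2.1,
        fun n m hn hm ↦ by
          -- An entry already present in `q` was checked against the promise of `p`; a later one
          -- meets the stronger promise of `q`.
          rcases lt_or_ge n q.values.length with hlt | hge
          · have h1 : q.values[n]? = some q.values[n] := List.getElem?_eq_getElem hlt
            have h2 := getElem?_eq_of_prefix hqr.2.1 h1
            rw [hm] at h2
            exact hpq.2.2 n m hn (h1.trans h2.symm)
          · exact anti hpq.1 (hqr.2.2 n m hge hm)⟩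
      le_antisymm := fun p q hpq hqp ↦ by
        have h1 := hpq.1.antisymm hqp.1
        have h2 := hpq.2.1.eq_of_length (hpq.2.1.length_le.antisymm hqp.2.1.length_le)
        cases p
        cases q
        cases h1
        cases h2
        rfl }
  have le_def : ∀ p q : P, p ≤ q ↔ p.promise ≤ q.promise ∧ p.values <+: q.values ∧
        ∀ n m, p.values.length ≤ n → q.values[n]? = some m → Good p.promise n m := fun _ _ ↦ Iff.rfl
  have hne : Nonempty P := by
    obtain ⟨a⟩ := ‹Nonempty A›
    obtain ⟨N, hN⟩ := ev a
    exact ⟨⟨a, List.replicate N 0, fun n hn ↦ hN n (by simpa using hn)⟩⟩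
  have compat : ∀ p q : P, p.values = q.values → Compatible p q := by
    rintro ⟨a, s, hp⟩ ⟨b, s', hq⟩ (rfl : s = s')
    -- The joint promise is feasible only from `N` on, so the common list is first prolonged to
    -- length `N` by values good for both promises.
    obtain ⟨N, hN⟩ := ev (a ⊔ b)
    obtain ⟨t, hst, htN, ht⟩ := exists_prefix_forall_getElem? (R := fun n m ↦ Good a n m ∧ Good b n m)
      s (fun n hn ↦ amalg (hp n hn) (hq n hn)) N
    exact ⟨⟨a ⊔ b, t, fun n hn ↦ hN n (htN.trans hn)⟩,
      (le_def _ _).2 ⟨le_sup_left, hst, fun n m hn hm ↦ (ht n m hn hm).1⟩,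
      (le_def _ _).2 ⟨le_sup_right, hst, fun n m hn hm ↦ (ht n m hn hm).2⟩⟩
  have hccc : CCC P := by
    intro S hS
    by_contra! hcon
    refine hS (Set.MapsTo.countable_of_injOn (f := fun p : P ↦ p.values) (t := Set.univ)
      (fun _ _ ↦ Set.mem_univ _) (fun p hp q hq hpq ↦ ?_) Set.countable_univ)
    by_contra hne
    exact hcon p hp q hq hne (compat p q hpq)
  let D : A × ℕ → Set P := fun c ↦ {p | c.1 ≤ p.promise ∧ c.2 ≤ p.values.length}
  have hD : ∀ c, IsDenseSet (D c) := by
    rintro ⟨c, k⟩ ⟨a, s, hp⟩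
    obtain ⟨N, hN⟩ := ev (a ⊔ c)
    obtain ⟨t, hst, htN, ht⟩ := exists_prefix_forall_getElem? (R := fun n m ↦ Good a n m)
      s (fun n hn ↦ (amalg (hp n hn) (hp n hn)).imp fun _ h ↦ h.1) (max N k)
    exact ⟨⟨a ⊔ c, t, fun n hn ↦ hN n ((le_max_left N k).trans (htN.trans hn))⟩,
      ⟨le_sup_right, (le_max_right N k).trans htN⟩, (le_def _ _).2 ⟨le_sup_left, hst, ht⟩⟩
  have hcard : #(Set.range D) ≤ κ := by
    refine Cardinal.mk_range_le.trans ?_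
    rw [Cardinal.mk_prod, Cardinal.lift_id', Cardinal.mk_nat, Cardinal.lift_aleph0]
    exact Cardinal.mul_le_of_le hκ (by simpa using hA) hκ
  obtain ⟨G, hG, hGD⟩ := hMA P hccc (Set.range D) hcard (by rintro _ ⟨c, rfl⟩; exact hD c)
  obtain ⟨a₀⟩ := ‹Nonempty A›
  have hlen : ∀ n : ℕ, ∃ (m : ℕ) (p : PromiseSequence Ex), p ∈ G ∧ p.values[n]? = some m := by
    intro n
    obtain ⟨p, hpG, -, hp⟩ := hGD _ ⟨(a₀, n + 1), rfl⟩
    exact ⟨_, p, hpG, List.getElem?_eq_getElem (Nat.lt_of_succ_le hp)⟩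
  choose f q hqG hq using hlen
  refine ⟨f, fun a ↦ ?_⟩
  obtain ⟨p, hpG, hpa, -⟩ := hGD _ ⟨(a, 0), rfl⟩
  refine ⟨p.values.length, fun n hn ↦ ?_⟩
  -- The bound `r` carries the entry `f n` inherited from `q n`, and must honour the promise of `p`
  -- at that index.
  obtain ⟨r, -, hpr, hqr⟩ := hG p hpG (q n) (hqG n)
  exact anti hpa (((le_def _ _).1 hpr).2.2 n (f n) hn
    (getElem?_eq_of_prefix ((le_def _ _).1 hqr).2.1 (hq n)))

/-! ### Cylinder functions and separability of the cube -/

/-- The continuous function on the Cantor cube `2^I` which is the indicator of the cylinder of all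
points with value `true` on the finite set `S`. -/
def cylinderFn (S : Finset I) : C(I → Bool, ℝ) :=
  ⟨fun x ↦ ∏ i ∈ S, if x i = true then 1 else 0, by
    refine continuous_finsetProd _ fun i _ ↦ ?_
    exact (continuous_of_discreteTopology (f := fun b : Bool ↦ if b = true then (1 : ℝ) else 0)).comp
      (continuous_apply i)⟩

open scoped Classical in
theorem cylinderFn_apply (S : Finset I) (x : I → Bool) :
    cylinderFn S x = if ∀ i ∈ S, x i = true then 1 else 0 :=
  Finset.prod_boole

theorem cylinderFn_congr {S : Finset I} {x y : I → Bool} (h : ∀ i ∈ S, x i = y i) :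
    cylinderFn S x = cylinderFn S y :=
  Finset.prod_congr rfl fun i hi ↦ by rw [h i hi]

open scoped Classical in
theorem cylinderFn_mul (S T : Finset I) : cylinderFn S * cylinderFn T = cylinderFn (S ∪ T) := by
  ext x
  simp only [ContinuousMap.mul_apply, cylinderFn_apply, Finset.mem_union, or_imp, forall_and]
  split_ifs <;> simp_all

/-- The cylinder functions span a dense subspace of `C(2^I)`. -/
theorem span_cylinderFn_topologicalClosure :
    (Submodule.span ℝ (Set.range (cylinderFn (I := I)))).topologicalClosure = ⊤ := by
  classical
  let M : Submonoid C(I → Bool, ℝ) :=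
    { carrier := Set.range cylinderFn
      one_mem' := ⟨∅, by ext x; simp [cylinderFn_apply]⟩
      mul_mem' := by
        rintro _ _ ⟨S, rfl⟩ ⟨T, rfl⟩
        exact ⟨S ∪ T, (cylinderFn_mul S T).symm⟩ }
  let B := Algebra.adjoin ℝ (Set.range (cylinderFn (I := I)))
  -- Cylinder functions are closed under products, so Stone–Weierstrass for the generated algebra is
  -- a statement about their linear span.
  have hspan : Subalgebra.toSubmodule B = Submodule.span ℝ (Set.range (cylinderFn (I := I))) := by
    have h : Submonoid.closure (Set.range (cylinderFn (I := I))) = M := Submonoid.closure_eq M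
    rw [Algebra.adjoin_eq_span, h]
    rfl
  have hsep : B.SeparatesPoints := by
    intro x y hxy
    obtain ⟨i, hi⟩ := Function.ne_iff.1 hxy
    refine ⟨_, ⟨cylinderFn {i}, Algebra.subset_adjoin ⟨{i}, rfl⟩, rfl⟩, fun h ↦ hi ?_⟩
    change cylinderFn {i} x = cylinderFn {i} y at h
    rw [cylinderFn_apply, cylinderFn_apply] at h
    cases hx : x i <;> cases hy : y i <;> simp_all
  have htop := ContinuousMap.subalgebra_topologicalClosure_eq_top_of_separatesPoints B hsep
  refine SetLike.coe_injective ?_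
  have h := congrArg (fun S : Subalgebra ℝ C(I → Bool, ℝ) ↦ (S : Set C(I → Bool, ℝ))) htop
  rw [← hspan]
  simpa using h

/-- A countable set of points of `2^I` realizing all finite patterns (the separability part of the
**Hewitt–Marczewski–Pondiczery theorem**). -/
theorem exists_countable_patterns (hI : #I ≤ 𝔠) :
    ∃ Q : Set (I → Bool), Q.Countable ∧
      ∀ (J : Finset I) (x : I → Bool), ∃ y ∈ Q, ∀ i ∈ J, y i = x i := by
  classical
  obtain ⟨r, hr⟩ : ∃ r : I → ℕ → Bool, Function.Injective r := by
    have h : Cardinal.lift.{0} #I ≤ Cardinal.lift.{u} #(ℕ → Bool) := by simpa using hI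
    obtain ⟨e⟩ := Cardinal.lift_mk_le'.1 h
    exact ⟨e, e.injective⟩
  -- With `I` embedded in `2^ℕ`, these are the indicators of clopen sets, of which there are
  -- countably many; they separate finite sets of indices.
  let F : (Σ n, Finset (Fin n → Bool)) → I → Bool :=
    fun c i ↦ decide ((fun k : Fin c.1 ↦ r i k) ∈ c.2)
  refine ⟨Set.range F, Set.countable_range F, fun J x ↦ ?_⟩
  have hsep : ∀ i j : I, ∃ n, i ≠ j → ∃ k < n, r i k ≠ r j k := by
    intro i j
    by_cases hij : i = j
    · exact ⟨0, fun h ↦ (h hij).elim⟩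
    · obtain ⟨k, hk⟩ := Function.ne_iff.1 (hr.ne hij)
      exact ⟨k + 1, fun _ ↦ ⟨k, Nat.lt_succ_self k, hk⟩⟩
  choose n hn using hsep
  let N := (J ×ˢ J).sup fun p ↦ n p.1 p.2
  let A : Finset (Fin N → Bool) := (J.filter fun i ↦ x i = true).image fun i k ↦ r i k
  refine ⟨F ⟨N, A⟩, ⟨_, rfl⟩, fun i hi ↦ ?_⟩
  have key : (fun k : Fin N ↦ r i k) ∈ A ↔ x i = true := by
    constructor
    · intro h
      obtain ⟨j, hj, hji⟩ := Finset.mem_image.1 h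
      obtain ⟨hjJ, hjx⟩ := Finset.mem_filter.1 hj
      by_cases hij : i = j
      · exact hij ▸ hjx
      · obtain ⟨k, hk, hne⟩ := hn i j hij
        have hkN : k < N := hk.trans_le
          (Finset.le_sup (f := fun p : I × I ↦ n p.1 p.2) (Finset.mk_mem_product hi hjJ))
        exact (hne (congrFun hji ⟨k, hkN⟩).symm).elim
    · intro h
      exact Finset.mem_image.2 ⟨i, Finset.mem_filter.2 ⟨hi, h⟩, rfl⟩
  change decide _ = _
  rw [Bool.eq_iff_iff, decide_eq_true_iff]
  exact key

/-! ### Amalgamation and approximation of functionals -/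

/-- Composition with a continuous self-map of `K` as a contraction of the dual of `C(K)`. -/
theorem exists_comp_dual {K : Type*} [TopologicalSpace K] [CompactSpace K] (π : C(K, K))
    (ν : StrongDual ℝ C(K, ℝ)) :
    ∃ μ : StrongDual ℝ C(K, ℝ), ‖μ‖ ≤ ‖ν‖ ∧ ∀ g, μ g = ν (g.comp π) := by
  refine ⟨LinearMap.mkContinuous
    { toFun := fun g ↦ ν (g.comp π)
      map_add' := fun f g ↦ by rw [← map_add]; rfl
      map_smul' := fun c g ↦ by rw [← map_smul]; rfl } ‖ν‖ fun g ↦ ?_, ?_, fun g ↦ rfl⟩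
  · refine (ν.le_opNorm _).trans (mul_le_mul_of_nonneg_left ?_ (norm_nonneg ν))
    exact (ContinuousMap.norm_le _ (norm_nonneg _)).2 fun x ↦ g.norm_coe_le_norm (π x)
  · exact LinearMap.mkContinuous_norm_le _ (norm_nonneg ν) _

/-- The retraction of `2^I` which replaces the coordinates outside `J` by `false`. -/
noncomputable def restrictTo (J : Finset I) : C(I → Bool, I → Bool) := by
  classical
  exact ⟨fun x i ↦ if i ∈ J then x i else false, continuous_pi fun i ↦ by
    split_ifs
    · exact continuous_apply i
    · exact continuous_const⟩

theorem cylinderFn_comp_restrictTo_of_subset {S J : Finset I} (h : S ⊆ J) :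
    (cylinderFn S).comp (restrictTo J) = cylinderFn S := by
  ext x
  exact cylinderFn_congr fun i hi ↦ by simp [restrictTo, h hi]

/-- A coordinate of `S` outside `J` is reset to `false`, which makes one factor of the product zero.
-/
theorem cylinderFn_comp_restrictTo_of_not_subset {S J : Finset I} (h : ¬ S ⊆ J) :
    (cylinderFn S).comp (restrictTo J) = 0 := by
  obtain ⟨i, hiS, hiJ⟩ := Finset.not_subset.1 h
  ext x
  exact Finset.prod_eq_zero hiS (by simp [restrictTo, hiJ])

/-- Amalgamation: two functionals can be replaced by a single one which on each `cylinderFn S` with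
`S ⊆ J` or `S ⊆ J'` takes the value of one of them. -/
theorem exists_amalgamation (J J' : Finset I) (ν ν' : StrongDual ℝ C(I → Bool, ℝ)) {r : ℝ}
    (hν : ‖ν‖ ≤ r) (hν' : ‖ν'‖ ≤ r) :
    ∃ μ : StrongDual ℝ C(I → Bool, ℝ), ‖μ‖ ≤ 3 * r ∧ ∀ S,
      (S ⊆ J' → μ (cylinderFn S) = ν' (cylinderFn S)) ∧
      (S ⊆ J → ¬ S ⊆ J' → μ (cylinderFn S) = ν (cylinderFn S)) := by
  classical
  obtain ⟨μ₁, h₁, e₁⟩ := exists_comp_dual (restrictTo J) ν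
  obtain ⟨μ₂, h₂, e₂⟩ := exists_comp_dual (restrictTo J') ν'
  obtain ⟨μ₃, h₃, e₃⟩ := exists_comp_dual (restrictTo (J ∩ J')) ν
  -- Inclusion–exclusion: `μ₃` removes the contribution of `ν` on cylinders over `J ∩ J'`, leaving
  -- `ν'` there. The three terms give the factor 3.
  refine ⟨μ₁ + μ₂ - μ₃, ?_, fun S ↦ ⟨fun hS ↦ ?_, fun hS hS' ↦ ?_⟩⟩
  · have := norm_sub_le (μ₁ + μ₂) μ₃
    have := norm_add_le μ₁ μ₂
    linarith
  · by_cases h : S ⊆ J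
    · simp [e₁, e₂, e₃, cylinderFn_comp_restrictTo_of_subset, h, hS, Finset.subset_inter_iff]
    · simp [e₁, e₂, e₃, cylinderFn_comp_restrictTo_of_subset,
        cylinderFn_comp_restrictTo_of_not_subset, h, hS, Finset.subset_inter_iff]
  · simp [e₁, e₂, e₃, cylinderFn_comp_restrictTo_of_subset,
        cylinderFn_comp_restrictTo_of_not_subset, hS, hS', Finset.subset_inter_iff]

/-- Evaluation at a point, as a functional on `C(K)`. -/
noncomputable def pointMass {K : Type*} [TopologicalSpace K] [CompactSpace K] (x : K) :
    StrongDual ℝ C(K, ℝ) :=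
  ContinuousMap.evalCLM ℝ x

/-- A functional composed with a map onto finitely many points is a combination of point masses. -/
theorem mem_span_pointMass {K ι : Type*} [TopologicalSpace K] [CompactSpace K] [Finite ι]
    (h : ι → K) (μ : StrongDual ℝ C(K, ℝ)) (hμ : ∀ g : C(K, ℝ), (∀ a, g (h a) = 0) → μ g = 0) :
    μ ∈ Submodule.span ℝ (Set.range fun a ↦ pointMass (h a)) := by
  have := Fintype.ofFinite ι
  have hmem : (μ : C(K, ℝ) →ₗ[ℝ] ℝ) ∈
      Submodule.span ℝ (Set.range fun a ↦ (pointMass (h a) : C(K, ℝ) →ₗ[ℝ] ℝ)) := by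
    refine mem_span_of_iInf_ker_le_ker fun g hg ↦ ?_
    simp only [Submodule.mem_iInf, LinearMap.mem_ker] at hg
    exact hμ g hg
  obtain ⟨c, hc⟩ := (Submodule.mem_span_range_iff_exists_fun ℝ).1 hmem
  refine (Submodule.mem_span_range_iff_exists_fun ℝ).2 ⟨c, ?_⟩
  ext g
  simpa using congrArg (fun l : C(K, ℝ) →ₗ[ℝ] ℝ ↦ l g) hc

/-- The elements of norm at most `r` in the span of a countable set are approximated by a
sequence of such elements. -/
theorem exists_seq_dense_span {E : Type*} [NormedAddCommGroup E] [NormedSpace ℝ E] {s : Set E}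
    (hs : s.Countable) {r : ℝ} (hr : 0 ≤ r) :
    ∃ d : ℕ → E, (∀ m, ‖d m‖ ≤ r) ∧
      ∀ x ∈ Submodule.span ℝ s, ‖x‖ ≤ r → ∀ ε, 0 < ε → ∃ m, ‖d m - x‖ < ε := by
  let B : Set E := {x | x ∈ Submodule.span ℝ s ∧ ‖x‖ ≤ r}
  have hB : TopologicalSpace.IsSeparable B :=
    (hs.isSeparable.span (R := ℝ)).mono fun x hx ↦ hx.1
  obtain ⟨D, hDB, hDc, hD⟩ := hB.exists_countable_dense_subset
  have hDne : D.Nonempty :=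
    closure_nonempty_iff.1 ⟨0, hD ⟨zero_mem _, by simpa using hr⟩⟩
  obtain ⟨d, rfl⟩ := hDc.exists_eq_range hDne
  refine ⟨d, fun m ↦ (hDB ⟨m, rfl⟩).2, fun x hx hxr ε hε ↦ ?_⟩
  obtain ⟨_, ⟨m, rfl⟩, hm⟩ := Metric.mem_closure_iff.1 (hD ⟨hx, hxr⟩) ε hε
  exact ⟨m, by rwa [dist_comm, dist_eq_norm] at hm⟩

/-- Countably many functionals approximate all functionals in a ball of `C(2^I)*` on the
cylinder functions over any finite set of coordinates. -/
theorem exists_seq_dense_functionals (hI : #I ≤ 𝔠) {r : ℝ} (hr : 0 ≤ r) :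
    ∃ d : ℕ → StrongDual ℝ C(I → Bool, ℝ), (∀ m, ‖d m‖ ≤ r) ∧
      ∀ (μ : StrongDual ℝ C(I → Bool, ℝ)), ‖μ‖ ≤ r → ∀ (J : Finset I) (ε : ℝ), 0 < ε →
        ∃ m, ∀ S ⊆ J, |d m (cylinderFn S) - μ (cylinderFn S)| < ε := by
  classical
  obtain ⟨Q, hQc, hQ⟩ := exists_countable_patterns hI
  obtain ⟨d, hd, hdense⟩ := exists_seq_dense_span (hQc.image pointMass) hr
  refine ⟨d, hd, fun μ hμ J ε hε ↦ ?_⟩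
  let ext : (J → Bool) → I → Bool := fun a i ↦ if h : i ∈ J then a ⟨i, h⟩ else false
  choose h hhQ hh using fun a : J → Bool ↦ hQ J (ext a)
  let π : C(I → Bool, I → Bool) := ⟨fun x ↦ h fun i ↦ x i,
    (continuous_of_discreteTopology (f := h)).comp
      (continuous_pi fun i ↦ continuous_apply (i : I))⟩
  have hπ : ∀ S ⊆ J, (cylinderFn S).comp π = cylinderFn S := by
    intro S hS
    ext x
    refine cylinderFn_congr fun i hi ↦ ?_
    change h (fun i ↦ x i) i = x i
    rw [hh _ i (hS hi)]
    simp [ext, hS hi]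
  obtain ⟨μ', hμ', e⟩ := exists_comp_dual π μ
  have hmem : μ' ∈ Submodule.span ℝ (pointMass '' Q) := by
    refine Submodule.span_mono ?_ (mem_span_pointMass h μ' fun g hg ↦ ?_)
    · rintro _ ⟨a, rfl⟩
      exact ⟨h a, hhQ a, rfl⟩
    · have : g.comp π = 0 := ContinuousMap.ext fun x ↦ hg _
      rw [e, this, map_zero]
  obtain ⟨m, hm⟩ := hdense μ' hmem (hμ'.trans hμ) ε hε
  refine ⟨m, fun S hS ↦ ?_⟩
  have h1 : μ (cylinderFn S) = μ' (cylinderFn S) := by rw [e, hπ S hS]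
  have h2 : ‖cylinderFn S‖ ≤ 1 := by
    refine (ContinuousMap.norm_le _ zero_le_one).2 fun x ↦ ?_
    rw [cylinderFn_apply]
    split_ifs <;> simp
  rw [h1, ← sub_apply, ← Real.norm_eq_abs]
  refine ((d m - μ').le_opNorm _).trans_lt ?_
  exact (mul_le_of_le_one_right (norm_nonneg _) h2).trans_lt hm

/-- Under `MA(κ)`, functionals of norm at most `r` which approximate given values on finitely many
cylinder functions of `2^κ` can be replaced by one sequence that asymptotically attains all of
them. -/
theorem exists_asymptotic_functionals {κ : Cardinal.{u}} (hκ : κ < 𝔠) (hMA : MartinsAxiomAt κ)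
    (hI : #I = κ) {r : ℝ} (hr : 0 ≤ r) (θ : Finset I → ℕ → ℝ)
    (hθ : ∀ (J : Finset I) (ε : ℝ), 0 < ε → ∀ᶠ n in cofinite,
      ∃ ν : StrongDual ℝ C(I → Bool, ℝ), ‖ν‖ ≤ r ∧ ∀ S ⊆ J, |ν (cylinderFn S) - θ S n| < ε) :
    ∃ μ : ℕ → StrongDual ℝ C(I → Bool, ℝ), (∀ n, ‖μ n‖ ≤ 3 * r) ∧
      ∀ S, Tendsto (fun n ↦ μ n (cylinderFn S) - θ S n) cofinite (𝓝 0) := by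
  classical
  obtain ⟨κ', hκ', hMA', hIκ'⟩ : ∃ κ' : Cardinal.{u}, ℵ₀ ≤ κ' ∧ MartinsAxiomAt κ' ∧ #I ≤ κ' := by
    rcases le_total ℵ₀ κ with h | h
    · exact ⟨κ, h, hMA, hI.le⟩
    · exact ⟨ℵ₀, le_rfl, martinsAxiomAt_aleph0, hI.trans_le h⟩
  obtain ⟨d, hd, hdense⟩ := exists_seq_dense_functionals (hI.trans_le hκ.le)
    (mul_nonneg zero_le_three hr)
  have hA : #(Finset I × ℕ) ≤ κ' := by
    rw [Cardinal.mk_prod, Cardinal.lift_id', Cardinal.mk_nat, Cardinal.lift_aleph0]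
    refine Cardinal.mul_le_of_le hκ' ?_ hκ'
    rcases finite_or_infinite I with h | h
    · exact Cardinal.mk_le_aleph0.trans hκ'
    · exact (Cardinal.mk_finset_of_infinite I).trans_le hIκ'
  have hpos : ∀ k : ℕ, (0 : ℝ) < 1 / (k + 1) := fun k ↦ Nat.one_div_pos_of_nat
  -- A promise is a pair `(J, k)` with tolerance `1 / (k + 1)`; `Good` doubles the tolerance to
  -- absorb the passage to a candidate `d m`.
  obtain ⟨f, hf⟩ := exists_uniformization hκ' hMA' hA
    (fun a n ↦ ∃ ν : StrongDual ℝ C(I → Bool, ℝ), ‖ν‖ ≤ r ∧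
      ∀ S ⊆ a.1, |ν (cylinderFn S) - θ S n| < 1 / (a.2 + 1))
    (fun a n m ↦ ∀ S ⊆ a.1, |d m (cylinderFn S) - θ S n| < 2 * (1 / (a.2 + 1)))
    (fun {a b n m} hab h S hS ↦ (h S (hS.trans (Prod.le_def.1 hab).1)).trans_le
      (mul_le_mul_of_nonneg_left (Nat.one_div_le_one_div (Prod.le_def.1 hab).2) zero_le_two))
    (fun a ↦ by
      have h := hθ a.1 _ (hpos a.2)
      rw [Nat.cofinite_eq_atTop] at h
      exact eventually_atTop.1 h)
    (by
      have main : ∀ {a b : Finset I × ℕ} {n : ℕ}, a.2 ≤ b.2 →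
          (∃ ν : StrongDual ℝ C(I → Bool, ℝ), ‖ν‖ ≤ r ∧
            ∀ S ⊆ a.1, |ν (cylinderFn S) - θ S n| < 1 / (a.2 + 1)) →
          (∃ ν : StrongDual ℝ C(I → Bool, ℝ), ‖ν‖ ≤ r ∧
            ∀ S ⊆ b.1, |ν (cylinderFn S) - θ S n| < 1 / (b.2 + 1)) →
          ∃ m, (∀ S ⊆ a.1, |d m (cylinderFn S) - θ S n| < 2 * (1 / (a.2 + 1))) ∧
            ∀ S ⊆ b.1, |d m (cylinderFn S) - θ S n| < 2 * (1 / (b.2 + 1)) := by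
        rintro a b n hab ⟨ν, hν, hνa⟩ ⟨ν', hν', hνb⟩
        -- On common cylinders the amalgam follows `ν'`, the functional of the finer tolerance,
        -- which serves both promises.
        obtain ⟨μ, hμ, hμS⟩ := exists_amalgamation a.1 b.1 ν ν' hν hν'
        obtain ⟨m, hm⟩ := hdense μ hμ (a.1 ∪ b.1) _ (hpos b.2)
        have hle : (1 : ℝ) / (b.2 + 1) ≤ 1 / (a.2 + 1) := Nat.one_div_le_one_div hab
        have hb : ∀ S ⊆ b.1, |d m (cylinderFn S) - θ S n| < 2 * (1 / (b.2 + 1)) := by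
          intro S hS
          have h1 := hm S (hS.trans Finset.subset_union_right)
          have h2 := hνb S hS
          rw [(hμS S).1 hS] at h1
          have h3 := abs_sub_le (d m (cylinderFn S)) (ν' (cylinderFn S)) (θ S n)
          linarith
        refine ⟨m, fun S hS ↦ ?_, hb⟩
        by_cases hSb : S ⊆ b.1
        · have := hb S hSb
          linarith
        · have h1 := hm S (hS.trans Finset.subset_union_left)
          have h2 := hνa S hS
          rw [(hμS S).2 hS hSb] at h1
          have h3 := abs_sub_le (d m (cylinderFn S)) (ν (cylinderFn S)) (θ S n)
          linarith
      intro a b n ha hb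
      rcases le_total a.2 b.2 with h | h
      · exact main h ha hb
      · exact (main h hb ha).imp fun _ h ↦ h.symm)
  refine ⟨fun n ↦ d (f n), fun n ↦ hd _, fun S ↦ ?_⟩
  rw [Nat.cofinite_eq_atTop, Metric.tendsto_atTop]
  intro ε hε
  obtain ⟨k, hk⟩ := exists_nat_one_div_lt (half_pos hε)
  obtain ⟨N, hN⟩ := hf (S, k)
  refine ⟨N, fun n hn ↦ ?_⟩
  have := hN n hn S subset_rfl
  rw [Real.dist_eq, sub_zero]
  simp only at this
  linarith

/-! ### The *extension property -/

/-- A function vanishing on a closed set with discrete complement is continuous as soon as it is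
small outside finite sets. -/
theorem continuous_of_finite_setOf_le_abs {X : Type*} [TopologicalSpace X] [T1Space X] {F : Set X}
    (hF : IsClosed F) (hd : DiscreteTopology (Fᶜ : Set X)) {h : X → ℝ} (h0 : ∀ y ∈ F, h y = 0)
    (hfin : ∀ ε : ℝ, 0 < ε → {y | ε ≤ |h y|}.Finite) : Continuous h := by
  refine continuous_iff_continuousAt.2 fun y ↦ ?_
  by_cases hy : y ∈ F
  · rw [ContinuousAt, h0 y hy, Metric.tendsto_nhds]
    intro ε hε
    have hopen : IsOpen {y | ε ≤ |h y|}ᶜ := (hfin ε hε).isClosed.isOpen_compl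
    have hmem : y ∈ {y | ε ≤ |h y|}ᶜ := by simp [h0 y hy, hε]
    filter_upwards [hopen.mem_nhds hmem] with z hz
    simpa [Real.dist_eq] using hz
  · have hopen : IsOpen ({y} : Set X) := by
      have := hF.isOpen_compl.isOpenMap_subtype_val _
        (isOpen_discrete ({⟨y, hy⟩} : Set (Fᶜ : Set X)))
      simpa using this
    rw [ContinuousAt, isOpen_singleton_iff_nhds_eq_pure _ |>.1 hopen]
    exact tendsto_pure_nhds _ _

/-- A compact set contained in the open discrete remainder is finite. -/
theorem finite_of_isClosed_of_discrete_compl {X : Type*} [TopologicalSpace X] [CompactSpace X]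
    {F T : Set X} (hd : DiscreteTopology (Fᶜ : Set X)) (hT : IsClosed T) (hTF : T ⊆ Fᶜ) :
    T.Finite := by
  have h : IsDiscrete (Fᶜ : Set X) := ⟨hd⟩
  exact hT.isCompact.finite (h.mono hTF)

instance compactSpace_measureBall (K : Type u) [TopologicalSpace K] [CompactSpace K] :
    CompactSpace (MeasureBall K) := by
  have h : {ν : WeakDual ℝ C(K, ℝ) | ‖WeakDual.toStrongDual ν‖ ≤ 1} =
      WeakDual.toStrongDual ⁻¹' Metric.closedBall (0 : StrongDual ℝ C(K, ℝ)) 1 := by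
    ext ν
    exact (mem_closedBall_zero_iff (a := WeakDual.toStrongDual ν)).symm
  have hc := WeakDual.isCompact_closedBall (𝕜 := ℝ) (0 : StrongDual ℝ C(K, ℝ)) 1
  rw [← h] at hc
  exact isCompact_iff_compactSpace.1 hc

/-- A uniformly bounded family of functionals which is pointwise continuous on a set spanning a
dense subspace is pointwise continuous. -/
theorem continuous_apply_of_dense_span {X E : Type*} [TopologicalSpace X] [NormedAddCommGroup E]
    [NormedSpace ℝ E] {s : Set E} (hs : (Submodule.span ℝ s).topologicalClosure = ⊤)
    {N : X → StrongDual ℝ E} {C : ℝ} (hN : ∀ y, ‖N y‖ ≤ C)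
    (hc : ∀ g ∈ s, Continuous fun y ↦ N y g) (g : E) : Continuous fun y ↦ N y g := by
  have hspan : ∀ g ∈ Submodule.span ℝ s, Continuous fun y ↦ N y g := by
    intro g hg
    induction hg using Submodule.span_induction with
    | mem g hg => exact hc g hg
    | zero => simpa using continuous_const
    | add f g _ _ hf hg =>
      simp only [map_add]
      exact hf.add hg
    | smul c g _ hg =>
      simp only [map_smul]
      exact hg.const_mul c
  refine continuous_of_uniform_approx_of_continuous fun u hu ↦ ?_
  obtain ⟨ε, hε, hεu⟩ := Metric.mem_uniformity_dist.1 hu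
  have hC : 0 < |C| + 1 := by positivity
  have hg : g ∈ closure (Submodule.span ℝ s : Set E) := by
    rw [← Submodule.topologicalClosure_coe, hs]
    trivial
  obtain ⟨f, hf, hfg⟩ := Metric.mem_closure_iff.1 hg (ε / (|C| + 1)) (div_pos hε hC)
  refine ⟨_, hspan f hf, fun y ↦ hεu ?_⟩
  rw [dist_eq_norm] at hfg ⊢
  rw [← map_sub]
  calc ‖N y (g - f)‖ ≤ ‖N y‖ * ‖g - f‖ := (N y).le_opNorm _
    _ ≤ (|C| + 1) * ‖g - f‖ := by
      gcongr
      linarith [hN y, le_abs_self C]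
    _ < ε := by rwa [lt_div_iff₀' hC] at hfg

/-- `MA(κ)` implies that `2^κ` has the *extension property for `κ < 𝔠`. -/
theorem starExtensionProperty_of_martinsAxiomAt {κ : Cardinal.{u}} (hκ : κ < 𝔠)
    (hMA : MartinsAxiomAt κ) (hI : #I = κ) : StarExtensionProperty.{u, w} (I → Bool) := by
  intro L' _ _ _ e he
  have hF : IsClosed (Set.range e) := (isCompact_range he.isEmbedding.continuous).isClosed
  have hclosed : IsClosedEmbedding e := ⟨he.isEmbedding, hF⟩
  have hdisc := he.discrete_compl
  have hτ : ∀ S : Finset I, ∃ t : C(L', ℝ), ∀ ν : MeasureBall (I → Bool),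
      t (e ν) = ν.1 (cylinderFn S) := by
    intro S
    let f : C(MeasureBall (I → Bool), ℝ) := ⟨fun ν ↦ ν.1 (cylinderFn S),
      (WeakDual.eval_continuous _).comp continuous_subtype_val⟩
    obtain ⟨t, ht⟩ := f.exists_extension' hclosed
    exact ⟨t, fun ν ↦ congrFun ht ν⟩
  choose τ hτ using hτ
  have hcount : Countable ((Set.range e)ᶜ : Set L') := he.countable_compl
  obtain ⟨φ, hφ⟩ := exists_injective_nat ((Set.range e)ᶜ : Set L')
  let θ : Finset I → ℕ → ℝ := fun S ↦ Function.extend φ (fun y ↦ τ S y) 0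
  have hθφ : ∀ S y, θ S (φ y) = τ S y := fun S y ↦ hφ.extend_apply _ _ y
  obtain ⟨μ, hμ, hμθ⟩ := exists_asymptotic_functionals hκ hMA hI zero_le_one θ (by
    intro J ε hε
    let T : Set L' := {y | ∃ ν : MeasureBall (I → Bool),
      ∀ S ∈ J.powerset, |ν.1 (cylinderFn S) - τ S y| < ε}ᶜ
    have hT : IsClosed T := by
      refine isClosed_compl_iff.2 ?_
      simp only [Set.ofPred_exists, Set.ofPred_forall]
      refine isOpen_iUnion fun ν ↦ isOpen_biInter_finset fun S _ ↦ ?_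
      exact isOpen_lt (continuous_const.sub (τ S).continuous).abs continuous_const
    -- A point `e ν` is approximated by `ν` itself, so the bad set is closed inside the discrete
    -- remainder, hence finite.
    have hTF : T ⊆ (Set.range e)ᶜ := by
      rintro y hy ⟨ν, rfl⟩
      exact hy ⟨ν, fun S _ ↦ by simpa [hτ] using hε⟩
    have hfin := finite_of_isClosed_of_discrete_compl hdisc hT hTF
    refine ((hfin.preimage Subtype.val_injective.injOn).image φ).subset ?_
    intro n hn
    by_cases hnφ : ∃ y, φ y = n
    · obtain ⟨y, rfl⟩ := hnφ
      refine ⟨y, fun ⟨ν, hν⟩ ↦ hn ⟨WeakDual.toStrongDual ν.1, ν.2, fun S hS ↦ ?_⟩, rfl⟩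
      rw [hθφ]
      exact hν S (Finset.mem_powerset.2 hS)
    -- Indices that code no point carry the default `θ = 0`, matched by the zero functional.
    · refine (hn ⟨0, ContinuousLinearMap.opNorm_zero.trans_le zero_le_one, fun S _ ↦ ?_⟩).elim
      have : θ S n = 0 := Function.extend_apply' _ _ _ hnφ
      simpa [this] using hε)
  have hN : ∀ y : L', ∃ N : StrongDual ℝ C(I → Bool, ℝ), ‖N‖ ≤ 3 * 1 ∧
      (∀ ν, e ν = y → N = WeakDual.toStrongDual ν.1) ∧
      ∀ h : y ∈ (Set.range e)ᶜ, N = μ (φ ⟨y, h⟩) := by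
    intro y
    by_cases hy : y ∈ Set.range e
    · obtain ⟨ν, rfl⟩ := hy
      exact ⟨WeakDual.toStrongDual ν.1, ν.2.trans (by norm_num),
        fun ν' h ↦ by rw [he.isEmbedding.injective h], fun h ↦ (h ⟨ν, rfl⟩).elim⟩
    · exact ⟨μ (φ ⟨y, hy⟩), hμ _, fun ν h ↦ (hy ⟨ν, h⟩).elim, fun _ ↦ rfl⟩
  choose N hN3 hNe hNμ using hN
  have hcyl : ∀ S, Continuous fun y ↦ N y (cylinderFn S) := by
    intro S
    have hdiff : Continuous fun y ↦ N y (cylinderFn S) - τ S y := by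
      refine continuous_of_finite_setOf_le_abs hF hdisc ?_ fun ε hε ↦ ?_
      · rintro _ ⟨ν, rfl⟩
        rw [hNe _ ν rfl, hτ]
        exact sub_self _
      · have hfin : {n | ε ≤ |μ n (cylinderFn S) - θ S n|}.Finite := by
          have h : ∀ᶠ n in cofinite, _ := (Metric.tendsto_nhds.1 (hμθ S)) ε hε
          simpa [Filter.eventually_cofinite, Real.dist_eq] using h
        refine ((hfin.preimage hφ.injOn).image Subtype.val).subset fun y hy ↦ ?_
        have hyF : y ∈ (Set.range e)ᶜ := by
          rintro ⟨ν, rfl⟩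
          rw [Set.mem_ofPred_eq, hNe _ ν rfl, hτ] at hy
          have : |(WeakDual.toStrongDual ν.1) (cylinderFn S) - ν.1 (cylinderFn S)| = 0 := by
            rw [abs_eq_zero]
            exact sub_self _
          linarith
        refine ⟨⟨y, hyF⟩, ?_, rfl⟩
        rw [Set.mem_ofPred_eq, hNμ y hyF] at hy
        simpa [hθφ] using hy
    exact (hdiff.add (τ S).continuous).congr fun y ↦ sub_add_cancel _ _
  have hcont := continuous_apply_of_dense_span span_cylinderFn_topologicalClosure hN3
    (by rintro _ ⟨S, rfl⟩; exact hcyl S)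
  refine ⟨LinearMap.mkContinuous
    { toFun := fun g ↦ ⟨fun y ↦ N y g, hcont g⟩
      map_add' := fun f g ↦ by ext y; simp
      map_smul' := fun c g ↦ by ext y; simp } (3 * 1) fun g ↦ ?_, fun g ν ↦ ?_⟩
  · refine (ContinuousMap.norm_le _ (by positivity)).2 fun y ↦ ?_
    exact ((N y).le_opNorm g).trans (mul_le_mul_of_nonneg_right (hN3 y) (norm_nonneg g))
  · change N (e ν) g = ν.1 g
    rw [hNe _ ν rfl]
    rfl

/-! ### Twisted sums -/

/-- A functional vanishing on the kernel of a surjective operator factors through it. -/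
theorem exists_factor_dual {X Y : Type*} [NormedAddCommGroup X] [NormedSpace ℝ X]
    [NormedAddCommGroup Y] [NormedSpace ℝ Y] (q : X →L[ℝ] Y) {C : ℝ} (hC : 0 ≤ C)
    (hq : ∀ y, ∃ x, q x = y ∧ ‖x‖ ≤ C * ‖y‖) (f : StrongDual ℝ X) (hf : ∀ x, q x = 0 → f x = 0) :
    ∃ ν : StrongDual ℝ Y, ‖ν‖ ≤ C * ‖f‖ ∧ ∀ x, ν (q x) = f x := by
  choose σ hσ hσC using hq
  have hfσ : ∀ x y, q x = y → f (σ y) = f x := by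
    intro x y h
    rw [← sub_eq_zero, ← map_sub]
    exact hf _ (by rw [map_sub, hσ, h, sub_self])
  refine ⟨LinearMap.mkContinuous
    { toFun := fun y ↦ f (σ y)
      map_add' := fun y z ↦ by
        rw [← map_add]
        exact hfσ _ _ (by rw [map_add, hσ, hσ])
      map_smul' := fun c y ↦ by
        rw [RingHom.id_apply, ← map_smul]
        exact hfσ _ _ (by rw [map_smul, hσ]) } (C * ‖f‖) fun y ↦ ?_, ?_, fun x ↦ hfσ x _ rfl⟩
  · calc ‖f (σ y)‖ ≤ ‖f‖ * ‖σ y‖ := f.le_opNorm _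
      _ ≤ ‖f‖ * (C * ‖y‖) := mul_le_mul_of_nonneg_left (hσC y) (norm_nonneg f)
      _ = C * ‖f‖ * ‖y‖ := by ring
  · exact LinearMap.mkContinuous_norm_le _ (mul_nonneg hC (norm_nonneg f)) _

theorem norm_apply_le_nullSeq (z : NullSeq) (n : ℕ) : ‖z n‖ ≤ ‖z‖ := by
  rw [← ZeroAtInftyContinuousMap.norm_toBCF_eq_norm]
  exact z.toBCF.norm_coe_le_norm n

theorem tendsto_nullSeq (z : NullSeq) : Tendsto z cofinite (𝓝 0) := by
  have h := z.zero_at_infty'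
  rwa [cocompact_eq_cofinite] at h

/-- The coordinate functionals on a copy of `c₀` extend to a bounded sequence of functionals. -/
theorem exists_coordinate_extensions {X : Type*} [NormedAddCommGroup X] [NormedSpace ℝ X]
    [CompleteSpace X] {i : NullSeq →L[ℝ] X} (hi : Function.Injective i)
    (hcl : IsClosed (Set.range i)) :
    ∃ (M : ℝ) (f : ℕ → StrongDual ℝ X), 0 ≤ M ∧ (∀ n, ‖f n‖ ≤ M) ∧ ∀ n z, f n (i z) = z n := by
  let c : ℕ → StrongDual ℝ NullSeq := fun n ↦ LinearMap.mkContinuous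
    { toFun := fun z ↦ z n
      map_add' := fun _ _ ↦ rfl
      map_smul' := fun _ _ ↦ rfl } 1 fun z ↦ by simpa using norm_apply_le_nullSeq z n
  have hc : ∀ n, ‖c n‖ ≤ 1 := fun n ↦ LinearMap.mkContinuous_norm_le _ zero_le_one _
  -- Open mapping theorem: the inverse is bounded on the closed range, so Hahn–Banach extends all
  -- coordinates with the common bound `‖S‖`.
  let T := i.equivRange hi hcl
  let S : (i : NullSeq →ₗ[ℝ] X).range →L[ℝ] NullSeq := T.symm
  have hS : ∀ z, S ⟨i z, z, rfl⟩ = z := fun z ↦ T.symm_apply_apply z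
  have hext : ∀ n, ∃ f : StrongDual ℝ X, ‖f‖ ≤ ‖S‖ ∧ ∀ z, f (i z) = z n := by
    intro n
    obtain ⟨f, hf, hfn⟩ := exists_extension_norm_eq _ ((c n).comp S)
    refine ⟨f, ?_, fun z ↦ ?_⟩
    · rw [hfn]
      exact ((c n).opNorm_comp_le S).trans (mul_le_of_le_one_left (norm_nonneg S) (hc n))
    · refine (hf ⟨i z, z, rfl⟩).trans ?_
      rw [ContinuousLinearMap.comp_apply, hS]
      rfl
  choose f hf hfz using hext
  exact ⟨‖S‖, f, norm_nonneg S, hf, hfz⟩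

/-- A bounded sequence of functionals converging weakly* to zero defines an operator to `c₀`. -/
theorem exists_operator_nullSeq {X : Type*} [NormedAddCommGroup X] [NormedSpace ℝ X]
    {f : ℕ → StrongDual ℝ X} {B : ℝ} (hB : 0 ≤ B) (hf : ∀ n, ‖f n‖ ≤ B)
    (h : ∀ x, Tendsto (fun n ↦ f n x) cofinite (𝓝 0)) :
    ∃ p : X →L[ℝ] NullSeq, ∀ x n, p x n = f n x := by
  refine ⟨LinearMap.mkContinuous
    { toFun := fun x ↦ ⟨⟨fun n ↦ f n x, continuous_of_discreteTopology⟩, by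
        rw [cocompact_eq_cofinite]
        exact h x⟩
      map_add' := fun x y ↦ by ext n; exact map_add (f n) x y
      map_smul' := fun c x ↦ by ext n; exact map_smul (f n) c x } B fun x ↦ ?_, fun x n ↦ rfl⟩
  rw [← ZeroAtInftyContinuousMap.norm_toBCF_eq_norm]
  refine (BoundedContinuousFunction.norm_le (by positivity)).2 fun n ↦ ?_
  exact ((f n).le_opNorm x).trans (mul_le_mul_of_nonneg_right (hf n) (norm_nonneg x))

/-- If the restrictions of a bounded sequence of functionals on `X` to the subspace `ker q` converge
weakly* to zero, then almost all of them are approximated on finitely many vectors by functionals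
that factor through `q`. -/
theorem eventually_exists_approx_factor {X Y : Type*} [NormedAddCommGroup X] [NormedSpace ℝ X]
    [NormedAddCommGroup Y] [NormedSpace ℝ Y] (q : X →L[ℝ] Y) {C : ℝ} (hC : 0 ≤ C)
    (hq : ∀ y, ∃ x, q x = y ∧ ‖x‖ ≤ C * ‖y‖) {M : ℝ} {f : ℕ → StrongDual ℝ X}
    (hf : ∀ n, ‖f n‖ ≤ M) (hker : ∀ x, q x = 0 → Tendsto (fun n ↦ f n x) cofinite (𝓝 0))
    (s : Finset X) {ε : ℝ} (hε : 0 < ε) :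
    ∀ᶠ n in cofinite, ∃ ν : StrongDual ℝ Y, ‖ν‖ ≤ C * M ∧ ∀ x ∈ s, |ν (q x) - f n x| < ε := by
  by_contra hcon
  have hne : (cofinite ⊓ 𝓟 {n | ¬ ∃ ν : StrongDual ℝ Y,
    ‖ν‖ ≤ C * M ∧ ∀ x ∈ s, |ν (q x) - f n x| < ε}).NeBot :=
    frequently_mem_iff_neBot.1 (not_eventually.1 hcon)
  -- An ultrafilter on the bad indices: its weak* limit `g` factors through `q`, and that factor
  -- approximates `f n` at some bad `n`.
  let U := Ultrafilter.of (cofinite ⊓ 𝓟 {n | ¬ ∃ ν : StrongDual ℝ Y,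
    ‖ν‖ ≤ C * M ∧ ∀ x ∈ s, |ν (q x) - f n x| < ε})
  have hU : (U : Filter ℕ) ≤ _ := Ultrafilter.of_le _
  have hUcof : (U : Filter ℕ) ≤ cofinite := hU.trans inf_le_left
  have hUbad := hU.trans inf_le_right
  have hcomp := WeakDual.isCompact_closedBall (𝕜 := ℝ) (0 : StrongDual ℝ X) M
  obtain ⟨g, hgM, hg⟩ := hcomp.ultrafilter_le_nhds (U.map fun n ↦ StrongDual.toWeakDual (f n)) (by
    refine le_principal_iff.2 (Filter.mem_map.2 (Filter.univ_mem' fun n ↦ ?_))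
    exact mem_closedBall_zero_iff.2 (hf n))
  have hlim : ∀ x, Tendsto (fun n ↦ f n x) U (𝓝 (g x)) := fun x ↦
    ((WeakDual.eval_continuous x).tendsto g).comp hg
  obtain ⟨ν, hν, hνg⟩ := exists_factor_dual q hC hq (WeakDual.toStrongDual g) fun x hx ↦
    tendsto_nhds_unique (hlim x) ((hker x hx).mono_left hUcof)
  have hnorm : ‖WeakDual.toStrongDual g‖ ≤ M := by simpa using hgM
  have hev : ∀ᶠ n in (U : Filter ℕ), ∀ x ∈ s, |ν (q x) - f n x| < ε := by
    refine (eventually_all_finset s).2 fun x _ ↦ ?_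
    have h := (Metric.tendsto_nhds.1 (hlim x)) ε hε
    filter_upwards [h] with n hn
    rw [hνg, abs_sub_comm]
    simpa [Real.dist_eq] using hn
  have hbad := le_principal_iff.1 hUbad
  obtain ⟨n, hn, hn'⟩ := (hev.and hbad).exists
  exact hn' ⟨ν, hν.trans (mul_le_mul_of_nonneg_left hnorm hC), hn⟩

/-- Under `MA(κ)`, for `κ < 𝔠`, every twisted sum of `c₀` and `C(2^κ)` is trivial. -/
theorem allTwistedSumsTrivial_of_martinsAxiomAt {κ : Cardinal.{u}} (hκ : κ < 𝔠)
    (hMA : MartinsAxiomAt κ) (hI : #I = κ) :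
    AllTwistedSumsTrivial.{u, v} C(I → Bool, ℝ) := by
  classical
  intro X _ _ _ i q hiq
  have hcl : IsClosed (Set.range i) := by
    have h : Set.range i = q ⁻¹' {0} := Set.ext fun x ↦ (hiq.exact x).symm
    rw [h]
    exact isClosed_singleton.preimage q.continuous
  have hqi : ∀ z, q (i z) = 0 := fun z ↦ (hiq.exact _).2 ⟨z, rfl⟩
  obtain ⟨C, hC, hq⟩ := q.exists_preimage_norm_le hiq.surjective
  obtain ⟨M, f, hM, hfM, hf⟩ := exists_coordinate_extensions hiq.injective hcl
  choose σ hσ using hiq.surjective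
  have hker : ∀ x, q x = 0 → Tendsto (fun n ↦ f n x) cofinite (𝓝 0) := by
    intro x hx
    obtain ⟨z, rfl⟩ := (hiq.exact x).1 hx
    simpa only [hf] using tendsto_nullSeq z
  obtain ⟨μ, hμ, hμθ⟩ := exists_asymptotic_functionals hκ hMA hI (mul_nonneg hC.le hM)
    (fun S n ↦ f n (σ (cylinderFn S))) fun J ε hε ↦ by
      filter_upwards [eventually_exists_approx_factor q hC.le hq hfM hker
        (J.powerset.image fun S ↦ σ (cylinderFn S)) hε] with n ⟨ν, hν, hνf⟩
      refine ⟨ν, hν, fun S hS ↦ ?_⟩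
      have := hνf _ (Finset.mem_image_of_mem _ (Finset.mem_powerset.2 hS))
      rwa [hσ] at this
  let y : ℕ → StrongDual ℝ X := fun n ↦ f n - (μ n).comp q
  let B := M + 3 * (C * M) * ‖q‖
  have hB : 0 ≤ B := by positivity
  have hyB : ∀ n, ‖y n‖ ≤ B := fun n ↦ by
    refine (norm_sub_le _ _).trans (add_le_add (hfM n) ?_)
    exact ((μ n).opNorm_comp_le q).trans (mul_le_mul_of_nonneg_right (hμ n) (norm_nonneg q))
  have hyi : ∀ n z, y n (i z) = z n := fun n z ↦ by simp [y, hf, hqi]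
  have hspan : ∀ g ∈ Submodule.span ℝ (Set.range (cylinderFn (I := I))),
      ∃ x, q x = g ∧ Tendsto (fun n ↦ y n x) cofinite (𝓝 0) := by
    intro g hg
    induction hg using Submodule.span_induction with
    | mem g hg =>
      obtain ⟨S, rfl⟩ := hg
      refine ⟨σ (cylinderFn S), hσ _, ?_⟩
      simpa [y, hσ] using (hμθ S).neg
    | zero => exact ⟨0, map_zero q, by simp⟩
    | add g g' _ _ hg hg' =>
      obtain ⟨x, rfl, hx⟩ := hg
      obtain ⟨x', rfl, hx'⟩ := hg'
      exact ⟨x + x', map_add q x x', by simpa only [map_add, add_zero] using hx.add hx'⟩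
    | smul c g _ hg =>
      obtain ⟨x, rfl, hx⟩ := hg
      exact ⟨c • x, map_smul q c x, by
        simpa only [map_smul, smul_eq_mul, mul_zero] using hx.const_mul c⟩
  have hy : ∀ x, Tendsto (fun n ↦ y n x) cofinite (𝓝 0) := by
    intro x
    rw [Metric.tendsto_nhds]
    intro ε hε
    have hden : 0 < (B + 1) * C := by positivity
    have hmem : q x ∈ closure
        (Submodule.span ℝ (Set.range (cylinderFn (I := I))) : Set C(I → Bool, ℝ)) := by
      rw [← Submodule.topologicalClosure_coe, span_cylinderFn_topologicalClosure]
      trivial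
    obtain ⟨g, hg, hgx⟩ := Metric.mem_closure_iff.1 hmem (ε / 2 / ((B + 1) * C)) (by positivity)
    -- Split `x = x' + i z + w`, with `x'` a lift of `g` from the span and `w` a small lift of the
    -- error; `y n` tends to zero on the first two terms.
    obtain ⟨x', rfl, hx'⟩ := hspan g hg
    obtain ⟨w, hw, hwC⟩ := hq (q x - q x')
    obtain ⟨z, hz⟩ := (hiq.exact (x - x' - w)).1 (by simp [hw])
    have hlim : Tendsto (fun n ↦ y n (x' + i z)) cofinite (𝓝 0) := by
      simpa only [map_add, hyi, add_zero] using hx'.add (tendsto_nullSeq z)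
    filter_upwards [(Metric.tendsto_nhds.1 hlim) (ε / 2) (half_pos hε)] with n hn
    have hx : x = (x' + i z) + w := by rw [hz]; abel
    have hyw : ‖y n w‖ < ε / 2 := by
      rw [dist_eq_norm, lt_div_iff₀' hden] at hgx
      calc ‖y n w‖ ≤ ‖y n‖ * ‖w‖ := (y n).le_opNorm w
        _ ≤ (B + 1) * (C * ‖q x - q x'‖) :=
          mul_le_mul ((hyB n).trans (by linarith)) hwC (norm_nonneg _) (by positivity)
        _ = (B + 1) * C * ‖q x - q x'‖ := by ring
        _ < ε / 2 := hgx
    rw [dist_zero_right] at hn ⊢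
    rw [hx, map_add]
    exact (norm_add_le _ _).trans_lt (by linarith)
  obtain ⟨p, hp⟩ := exists_operator_nullSeq hB hyB hy
  refine ⟨p, ?_⟩
  ext z n
  exact (hp _ n).trans (hyi n z)

end TwistedSums

theorem corollary5p2 :
    (∀ κ : Cardinal.{u}, κ < 𝔠 → TwistedSums.MartinsAxiomAt.{u} κ →
      ∀ I : Type u, #I = κ →
        TwistedSums.StarExtensionProperty.{u, w} (I → Bool) ∧
        TwistedSums.AllTwistedSumsTrivial.{u, v} C(I → Bool, ℝ)) ∧
    (TwistedSums.MartinsAxiom.{u} → ¬ TwistedSums.ContinuumHypothesis.{u} →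
      ∀ I : Type u, #I = ℵ₁ →
        TwistedSums.AllTwistedSumsTrivial.{u, v} C(I → Bool, ℝ)) := by
  refine ⟨fun κ hκ hMA I hI ↦ ⟨TwistedSums.starExtensionProperty_of_martinsAxiomAt hκ hMA hI,
    TwistedSums.allTwistedSumsTrivial_of_martinsAxiomAt hκ hMA hI⟩, fun hMA hCH I hI ↦ ?_⟩
  have h : (ℵ₁ : Cardinal.{u}) < 𝔠 := Cardinal.aleph_one_le_continuum.lt_of_ne fun h ↦ hCH h.symm
  exact TwistedSums.allTwistedSumsTrivial_of_martinsAxiomAt h (hMA _ h) hI
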